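/- Let $S$ be a string of length $n\ge 2$ over an arbitrary alphabet, with positions $0,\dots,n-1$, and let $A$ be its Manacher array: for $0\le i\le 2n-2$, the entry $A[i]$ is the maximal palindrome of $S$ with centre $i/2$, given by its start position and its length. Here a substring $S[a..b]$ has centre $\frac{a+b}{2}$ (the empty substring, with $b=a-1$, is allowed), and a palindromic substring $S[a..b]$ is maximal if $S[a-1..b+1]$ is undefined or is not a palindrome. Consider the word-RAM with words of $w=\Omega(\log n)$ bits, where a word is large enough to hold an index of $A$ (precisely, $2^w\ge 2n$), with unit-cost arithmetic, bitwise, shift, comparison and memory-read operations. Then there is a data structure for $S$ that occupies $O\left(\frac{n}{\log n}\right)$ words and supports querying the maximal palindrome $A[i]$ for every index $i$ in $O(\log^* n)$ time. More precisely, there are one fixed query program and one constant $C$, independent of $n$, $w$, the alphabet and $S$, such that for all such $S$ and $w$ there is a memory content of at most $C\,\frac{n}{\log_2 n}$ words of $w$ bits with which the program, on every input $0\le i\le 2n-2$, halts after at most $C\log^* n$ steps and returns the start position and the length of $A[i]$. Here $\log^* n$ is the number of times $\log_2$ has to be applied to $n$ until the value is at most $1$. -/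

import Mathlib

/-- The substring of `S` of length `l` that starts at position `a` (positions count from `0`). -/
def substr {α : Type*} (S : List α) (a l : ℕ) : List α := (S.drop a).take l

/-- `S[a, a + l)` is a maximal palindrome of `S` with centre `i / 2`: it lies in `S`, the midpoint
of its first position `a` and its last position `a + l - 1` is `i / 2`, it is a palindrome, and its
extension by one character on both sides is either undefined or not a palindrome.
The length `l = 0` (the empty palindrome between two characters) is possible for odd `i`. -/
structure IsMaximalPalindromeAt {α : Type*} (S : List α) (i a l : ℕ) : Prop where
  inside : a + l ≤ S.length
  center : 2 * a + l = i + 1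
  palindrome : (substr S a l).Palindrome
  maximal : a = 0 ∨ a + l = S.length ∨ ¬ (substr S (a - 1) (l + 2)).Palindrome

/-- `A` is the Manacher array of `S`: for each of the `2 |S| - 1` centres `i / 2` it holds the
maximal palindrome with that centre, as the pair (start position, length). -/
def IsManacherArray {α : Type*} (S : List α) (A : Fin (2 * S.length - 1) → ℕ × ℕ) : Prop :=
  ∀ i : Fin (2 * S.length - 1), IsMaximalPalindromeAt S i (A i).1 (A i).2

/-- Every string has a Manacher array. -/
theorem exists_isManacherArray {α : Type*} (S : List α) : ∃ A, IsManacherArray S A := by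
  have key : ∀ i : Fin (2 * S.length - 1),
      ∃ p : ℕ × ℕ, IsMaximalPalindromeAt S i p.1 p.2 := by
    intro i
    let Q : ℕ → Prop := fun l =>
      ∃ a, a + l ≤ S.length ∧ 2 * a + l = i + 1 ∧ (substr S a l).Palindrome
    have hi := i.isLt
    have h₀ : Q ((i + 1) % 2) := by
      refine ⟨(i + 1) / 2, by omega, by omega, ?_⟩
      have hl : (substr S ((i + 1) / 2) ((i + 1) % 2)).length ≤ 1 := by
        have := List.length_take_le ((i + 1) % 2 : ℕ) (S.drop ((i + 1) / 2))
        simp only [substr]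
        omega
      match substr S ((i + 1) / 2) ((i + 1) % 2), hl with
      | [], _ => exact .nil
      | [x], _ => exact .singleton x
    classical
    obtain ⟨a, h₁, h₂, h₃⟩ :=
      Nat.findGreatest_spec (P := Q) (n := S.length) (m := (i + 1) % 2) (by omega) h₀
    refine ⟨(a, Nat.findGreatest Q S.length), h₁, h₂, h₃, ?_⟩
    by_contra! hc
    obtain ⟨c₁, c₂, c₃⟩ := hc
    dsimp only at c₁ c₂ c₃
    have := Nat.le_findGreatest (P := Q) (n := S.length)
      (m := Nat.findGreatest Q S.length + 2) (by omega) ⟨a - 1, by omega, by omega, c₃⟩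
    omega
  choose A hA using key
  exact ⟨A, hA⟩

/-- The iterated logarithm to base `2`: the number of times `log₂` has to be applied to `n` until
the value is at most `1`. Rounding up in between, as `Nat.clog` does, does not change this
number. -/
def logStar (n : ℕ) : ℕ :=
  if 1 < n then logStar (Nat.clog 2 n) + 1 else 0
termination_by n
decreasing_by
  rename_i h
  have h₁ : Nat.clog 2 n ≤ n - 1 :=
    Nat.clog_le_of_le_pow (by have := Nat.lt_two_pow_self (n := n - 1); omega)
  omega

/-! A word-RAM with words of `w` bits. A program is a fixed finite text, independent of `w`.
It works on registers that hold one word each, and it can read, but not change, the memory. -/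

namespace WordRAM

/-- The unit-cost operations on words. -/
inductive BinOp
  | add | sub | mul | div | mod | and | or | xor | shl | shr | lt | eq

/-- Arithmetic is unsigned and modulo `2 ^ w`; comparisons return `1` or `0`. -/
def BinOp.eval {w : ℕ} : BinOp → BitVec w → BitVec w → BitVec w
  | .add, x, y => x + y
  | .sub, x, y => x - y
  | .mul, x, y => x * y
  | .div, x, y => x / y
  | .mod, x, y => x % y
  | .and, x, y => x &&& y
  | .or,  x, y => x ||| y
  | .xor, x, y => x ^^^ y
  | .shl, x, y => x <<< y
  | .shr, x, y => x >>> y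
  | .lt,  x, y => if x < y then 1#w else 0#w
  | .eq,  x, y => if x = y then 1#w else 0#w

/-- Programs. The registers are numbered by `ℕ`; each program mentions only finitely many. -/
inductive Program
  | skip
  /-- `const d c`: register `d` gets the constant `c`. -/
  | const (d c : ℕ)
  /-- `op o d a b`: register `d` gets the result of `o` on the registers `a` and `b`. -/
  | op (o : BinOp) (d a b : ℕ)
  /-- `load d a`: register `d` gets the memory cell whose address is in register `a`. -/
  | load (d a : ℕ)
  | seq (P Q : Program)
  /-- `ite a P Q`: run `P` if register `a` is not zero, and `Q` otherwise. -/
  | ite (a : ℕ) (P Q : Program)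
  /-- `loop a P`: run `P` as long as register `a` is not zero. -/
  | loop (a : ℕ) (P : Program)

/-- The contents of the registers. -/
abbrev Regs (w : ℕ) := ℕ → BitVec w

/-- `Exec D P s s' t`: with memory `D`, the program `P` started with register contents `s` halts
after `t` steps with register contents `s'`. Each instruction and each test is one step, and a
program that reads outside of `D` has no execution. -/
inductive Exec {w : ℕ} (D : List (BitVec w)) : Program → Regs w → Regs w → ℕ → Prop
  | skip (s : Regs w) : Exec D .skip s s 1
  | const (d c : ℕ) (s : Regs w) :
      Exec D (.const d c) s (Function.update s d (BitVec.ofNat w c)) 1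
  | op (o : BinOp) (d a b : ℕ) (s : Regs w) :
      Exec D (.op o d a b) s (Function.update s d (o.eval (s a) (s b))) 1
  | load (d a : ℕ) (s : Regs w) (v : BitVec w) (h : D[(s a).toNat]? = some v) :
      Exec D (.load d a) s (Function.update s d v) 1
  | seq {P Q : Program} {s s₁ s₂ : Regs w} {t₁ t₂ : ℕ}
      (hP : Exec D P s s₁ t₁) (hQ : Exec D Q s₁ s₂ t₂) : Exec D (.seq P Q) s s₂ (t₁ + t₂)
  | ite_true {a : ℕ} {P Q : Program} {s s₁ : Regs w} {t : ℕ}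
      (h : s a ≠ 0#w) (hP : Exec D P s s₁ t) : Exec D (.ite a P Q) s s₁ (t + 1)
  | ite_false {a : ℕ} {P Q : Program} {s s₁ : Regs w} {t : ℕ}
      (h : s a = 0#w) (hQ : Exec D Q s s₁ t) : Exec D (.ite a P Q) s s₁ (t + 1)
  | loop_stop {a : ℕ} {P : Program} {s : Regs w}
      (h : s a = 0#w) : Exec D (.loop a P) s s 1
  | loop_step {a : ℕ} {P : Program} {s s₁ s₂ : Regs w} {t₁ t₂ : ℕ}
      (h : s a ≠ 0#w) (hP : Exec D P s s₁ t₁) (hL : Exec D (.loop a P) s₁ s₂ t₂) :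
      Exec D (.loop a P) s s₂ (t₁ + t₂ + 1)

/-- The initial registers on input `i`: register `0` holds `i`, all others are zero. -/
def input (w i : ℕ) : Regs w := Function.update (fun _ => 0#w) 0 (BitVec.ofNat w i)

end WordRAM

/-!
The `2 * n - 1` centres are split into blocks of `m ≈ (log₂ n) / 11` consecutive centres.

Two palindromes of length at least `2 * m` with centres in one block overlap so much that they
force a period less than `m`. All long maximal palindromes of the block then extend to the nearer
boundary of one maximal run with this period, except for the one centred in the middle of the run.
So three numbers per block describe them.

The shorter palindromes of a block lie in a window of `3 * m` characters. As in Manacher's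
algorithm, the Manacher array of the window is determined by the rightmost ends of the palindromes
seen so far, which form a monotone lattice path. Hence there are at most `2 ^ (9 * m)` such arrays,
whatever the alphabet is, and a table of all of them takes `2 ^ (9 * m) * (6 * m)` words, which is
less than `n / log₂ n` up to a constant. A query reads the record of its block and one table entry,
in constant time. For bounded `n` the lengths are stored without compression.
-/

section Palindromes

variable {α : Type*} {S : List α} {a e i k l x : ℕ}

theorem length_substr (S : List α) (x N : ℕ) : (substr S x N).length = min N (S.length - x) := by
  simp only [substr, List.length_take, List.length_drop]

theorem getElem?_substr {N : ℕ} (h : k < N) : (substr S x N)[k]? = S[x + k]? := by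
  simp only [substr, List.getElem?_take_of_lt h, List.getElem?_drop]

/-- The positions `a, …, e - 1` of `S` read the same in both directions. This form of
palindromicity refers to positions of `S` only, so that reflections can be composed. -/
def IsPalindromeOn (S : List α) (a e : ℕ) : Prop :=
  ∀ x y, a ≤ x → a ≤ y → x + y + 1 = a + e → S[x]? = S[y]?

theorem palindrome_iff_isPalindromeOn : S.Palindrome ↔ IsPalindromeOn S 0 S.length := by
  rw [List.Palindrome.iff_reverse_eq]
  constructor
  · intro hrev x y _ _ hxy
    rw [← hrev, List.getElem?_reverse (by omega), hrev]
    congr 1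
    omega
  · intro hpal
    refine List.ext_getElem? fun x => ?_
    rcases lt_or_ge x S.length with hx | hx
    · rw [List.getElem?_reverse hx]
      exact hpal _ _ (by omega) (by omega) (by omega)
    · rw [List.getElem?_eq_none (by rwa [List.length_reverse]), List.getElem?_eq_none hx]

theorem isPalindromeOn_substr_iff {N : ℕ} (h : e ≤ N) :
    IsPalindromeOn (substr S x N) a e ↔ IsPalindromeOn S (x + a) (x + e) := by
  constructor
  · intro hpal y z hy hz hyz
    have := hpal (y - x) (z - x) (by omega) (by omega) (by omega)
    rwa [getElem?_substr (by omega), getElem?_substr (by omega),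
      Nat.add_sub_of_le (by omega), Nat.add_sub_of_le (by omega)] at this
  · intro hpal y z hy hz hyz
    rw [getElem?_substr (by omega), getElem?_substr (by omega)]
    exact hpal _ _ (by omega) (by omega) (by omega)

theorem palindrome_substr_iff (h : a + l ≤ S.length) :
    (substr S a l).Palindrome ↔ IsPalindromeOn S a (a + l) := by
  have hlen : (substr S a l).length = l := by rw [length_substr]; omega
  rw [palindrome_iff_isPalindromeOn, hlen, isPalindromeOn_substr_iff le_rfl, add_zero]

theorem IsPalindromeOn.extend (h : IsPalindromeOn S (a + 1) e) (heq : S[a]? = S[e]?) :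
    IsPalindromeOn S a (e + 1) := by
  intro x y hx hy hxy
  rcases hx.eq_or_lt with rfl | hx
  · rw [heq, show y = e by omega]
  rcases hy.eq_or_lt with rfl | hy
  · rw [heq, show x = e by omega]
  exact h x y hx hy (by omega)

theorem IsPalindromeOn.mirror {A E : ℕ} (hA : IsPalindromeOn S A E) (ha : IsPalindromeOn S a e)
    (hAa : A ≤ a) (heE : e ≤ E) : IsPalindromeOn S (A + E - e) (A + E - a) := by
  intro x y hx hy hxy
  rw [hA x (A + E - 1 - x) (by omega) (by omega) (by omega),
    hA y (A + E - 1 - y) (by omega) (by omega) (by omega)]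
  exact ha _ _ (by omega) (by omega) (by omega)

namespace IsMaximalPalindromeAt

theorem isPalindromeOn (h : IsMaximalPalindromeAt S i a l) : IsPalindromeOn S a (a + l) :=
  (palindrome_substr_iff h.inside).1 h.palindrome

theorem ne_of_interior (h : IsMaximalPalindromeAt S i a l) (ha : a ≠ 0)
    (hl : a + l ≠ S.length) : S[a - 1]? ≠ S[a + l]? := by
  intro heq
  have hin := h.inside
  have hext : IsPalindromeOn S (a - 1) (a + l + 1) :=
    IsPalindromeOn.extend (by rw [Nat.sub_add_cancel (by omega)]; exact h.isPalindromeOn) heq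
  rcases h.maximal with h' | h' | h'
  · exact ha h'
  · exact hl h'
  · rw [palindrome_substr_iff (by omega), show a - 1 + (l + 2) = a + l + 1 by omega] at h'
    exact h' hext

theorem isPalindromeOn_iff {a' e' : ℕ} (h : IsMaximalPalindromeAt S i a l)
    (he : e' ≤ S.length) (hc : a' + e' = i + 1) : IsPalindromeOn S a' e' ↔ e' - a' ≤ l := by
  have hca := h.center
  constructor
  · intro hpal
    by_contra hlt
    exact h.ne_of_interior (by omega) (by omega)
      (hpal (a - 1) (a + l) (by omega) (by omega) (by omega))
  · intro hle x y hx hy hxy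
    exact h.isPalindromeOn x y (by omega) (by omega) (by omega)

end IsMaximalPalindromeAt

/-- The length of the maximal palindrome of `S` with centre `i / 2`, and `0` if there is no such
centre. -/
noncomputable def manacherLen (S : List α) (i : ℕ) : ℕ :=
  if h : i < 2 * S.length - 1 then ((exists_isManacherArray S).choose ⟨i, h⟩).2 else 0

/-- The start position of the maximal palindrome of `S` with centre `i / 2`. -/
noncomputable def manacherStart (S : List α) (i : ℕ) : ℕ := (i + 1 - manacherLen S i) / 2

theorem isMaximalPalindromeAt_manacher (h : i < 2 * S.length - 1) :
    IsMaximalPalindromeAt S i (manacherStart S i) (manacherLen S i) := by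
  have hmax := (exists_isManacherArray S).choose_spec ⟨i, h⟩
  have hc := hmax.center
  have hlen : manacherLen S i = ((exists_isManacherArray S).choose ⟨i, h⟩).2 := dif_pos h
  have hstart : manacherStart S i = ((exists_isManacherArray S).choose ⟨i, h⟩).1 := by
    simp only [manacherStart, hlen] at hc ⊢
    omega
  rwa [hstart, hlen]

theorem IsMaximalPalindromeAt.eq_manacher (h : IsMaximalPalindromeAt S i a l)
    (hi : i < 2 * S.length - 1) : (a, l) = (manacherStart S i, manacherLen S i) := by
  have h' := isMaximalPalindromeAt_manacher hi
  have hc := h.center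
  have hc' := h'.center
  have hle := (h'.isPalindromeOn_iff h.inside (by omega)).1 h.isPalindromeOn
  have hge := (h.isPalindromeOn_iff h'.inside (by omega)).1 h'.isPalindromeOn
  rw [Prod.mk.injEq]
  omega

theorem manacherLen_eq_zero (h : 2 * S.length - 1 ≤ i) : manacherLen S i = 0 :=
  dif_neg (by omega)

end Palindromes

/-! ### Long palindromes with nearby centres -/

section Runs

variable {α : Type*} {S : List α} {a b e i j k l m p s : ℕ}

/-- `p` is a period of the factor of `S` at the positions `s, …, e - 1`. -/
def HasPeriodOn (S : List α) (p s e : ℕ) : Prop :=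
  ∀ x, s ≤ x → x + p < e → S[x]? = S[x + p]?

/-- `s, …, e - 1` is a maximal interval of positions of `S` with period `p`. -/
structure IsMaximalRun (S : List α) (p s e : ℕ) : Prop where
  inside : e ≤ S.length
  period : HasPeriodOn S p s e
  left : s ≠ 0 → S[s - 1]? ≠ S[s - 1 + p]?
  right : e ≠ S.length → S[e - p]? ≠ S[e]?

theorem HasPeriodOn.extend_left (h : HasPeriodOn S p (s + 1) e) (heq : S[s]? = S[s + p]?) :
    HasPeriodOn S p s e := by
  intro x hx hxe
  rcases hx.eq_or_lt with rfl | hx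
  · exact heq
  · exact h x hx hxe

theorem HasPeriodOn.extend_right (h : HasPeriodOn S p s e) (heq : S[e - p]? = S[e]?) :
    HasPeriodOn S p s (e + 1) := by
  intro x hx hxe
  rcases (Nat.lt_succ_iff.1 hxe).eq_or_lt with rfl | hxe
  · rwa [Nat.add_sub_cancel] at heq
  · exact h x hx hxe

theorem HasPeriodOn.exists_isMaximalRun (h : HasPeriodOn S p a b) (hb : b ≤ S.length) :
    ∃ s e, s ≤ a ∧ b ≤ e ∧ IsMaximalRun S p s e := by
  classical
  have hex : ∃ s, HasPeriodOn S p s b := ⟨a, h⟩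
  obtain ⟨s, hsa, hs, hsmin⟩ :
      ∃ s ≤ a, HasPeriodOn S p s b ∧ ∀ s' < s, ¬ HasPeriodOn S p s' b :=
    ⟨Nat.find hex, Nat.find_min' hex h, Nat.find_spec hex, fun _ => Nat.find_min hex⟩
  obtain ⟨e, hbe, hen, he, hemax⟩ : ∃ e, b ≤ e ∧ e ≤ S.length ∧ HasPeriodOn S p s e ∧
      ∀ e', e < e' → e' ≤ S.length → ¬ HasPeriodOn S p s e' :=
    ⟨Nat.findGreatest (HasPeriodOn S p s) S.length, Nat.le_findGreatest hb hs,
      Nat.findGreatest_le _, Nat.findGreatest_spec hb hs,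
      fun _ => Nat.findGreatest_is_greatest⟩
  refine ⟨s, e, hsa, hbe, hen, he, fun h₀ heq => ?_, fun h₀ heq => ?_⟩
  · refine hsmin (s - 1) (by omega) (HasPeriodOn.extend_left ?_ heq)
    rwa [Nat.sub_add_cancel (by omega)]
  · exact hemax (e + 1) (by omega) (by omega) (he.extend_right heq)

/-- The composition of the reflections at the two centres is a shift. -/
theorem IsPalindromeOn.hasPeriodOn {a' b' : ℕ} (h : IsPalindromeOn S a b)
    (h' : IsPalindromeOn S a' b') (hle : a + b ≤ a' + b') :
    HasPeriodOn S (a' + b' - (a + b)) (max a a') (min b b') := by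
  intro x hx hxb
  rw [h x (a + b - 1 - x) (by omega) (by omega) (by omega)]
  exact h' _ _ (by omega) (by omega) (by omega)

theorem IsMaximalPalindromeAt.start_eq_of_isMaximalRun (hk : IsMaximalPalindromeAt S k a l)
    (hr : IsMaximalRun S p s e) (hp : 0 < p) (hpl : p ≤ l) (hs : 2 * s + p ≤ k)
    (he : k + 1 + p ≤ 2 * e) (hne : k + 1 ≠ s + e) : a = max s (k + 1 - e) := by
  have hc := hk.center
  have hin := hk.inside
  have hen := hr.inside
  have hpal := hk.isPalindromeOn
  -- Reflecting the mismatch at one end of the run gives a mismatch inside the run.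
  have not_past_left : a < s → ¬ k + 1 < s + e := fun h₁ h₂ => hr.left (by omega) <| by
    rw [hpal (s - 1) (k + 1 - s) (by omega) (by omega) (by omega),
      hpal (s - 1 + p) (k + 1 - s - p) (by omega) (by omega) (by omega),
      hr.period (k + 1 - s - p) (by omega) (by omega)]
    congr 1
    omega
  have not_past_right : e < a + l → ¬ s + e < k + 1 := fun h₁ h₂ => hr.right (by omega) <| by
    rw [hpal (e - p) (k - e + p) (by omega) (by omega) (by omega),
      hpal e (k - e) (by omega) (by omega) (by omega)]
    exact (hr.period (k - e) (by omega) (by omega)).symm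
  -- Shifting the two characters around the palindrome by a period moves them inside it.
  have not_interior : s < a → ¬ a + l < e := fun h₁ h₂ =>
    hk.ne_of_interior (by omega) (by omega) <| by
      rw [hr.period (a - 1) (by omega) (by omega),
        hpal (a - 1 + p) (a + l - p) (by omega) (by omega) (by omega),
        hr.period (a + l - p) (by omega) (by omega)]
      congr 1
      omega
  omega

/-- Three numbers that describe the long maximal palindromes with centres in a short interval: the
ends of a maximal run, and the start of the palindrome centred in the middle of this run, the only
one that can extend beyond both ends of the run. -/
structure RunSummary where
  runStart : ℕ
  runEnd : ℕ
  centralStart : ℕ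

/-- The start position, according to `R`, of the long maximal palindrome with centre `k / 2`. -/
def RunSummary.palindromeStart (R : RunSummary) (k : ℕ) : ℕ :=
  if k + 1 = R.runStart + R.runEnd then R.centralStart else max R.runStart (k + 1 - R.runEnd)

/-- The centres `k / 2` with `b ≤ k < b + m` whose maximal palindromes have at least `2 * m`
characters, so that two of them have a long overlap. -/
def longCenters (S : List α) (b m : ℕ) : Set ℕ :=
  {k | b ≤ k ∧ k < b + m ∧ k < 2 * S.length - 1 ∧ 2 * m ≤ manacherLen S k}

theorem exists_isMaximalRun_of_longCenters (hi : i ∈ longCenters S b m)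
    (hj : j ∈ longCenters S b m) (hij : i < j) :
    ∃ s e, IsMaximalRun S (j - i) s e ∧
      ∀ k ∈ longCenters S b m, 2 * s + (j - i) ≤ k ∧ k + 1 + (j - i) ≤ 2 * e := by
  obtain ⟨hbi, -, hin, hil⟩ := hi
  obtain ⟨-, hjb, hjn, hjl⟩ := hj
  have hmi := isMaximalPalindromeAt_manacher hin
  have hmj := isMaximalPalindromeAt_manacher hjn
  have hci := hmi.center
  have hcj := hmj.center
  have hii := hmi.inside
  have hper := hmi.isPalindromeOn.hasPeriodOn hmj.isPalindromeOn (by omega)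
  obtain ⟨s, e, hs, he, hr⟩ := hper.exists_isMaximalRun (by omega)
  refine ⟨s, e, ?_, fun k ⟨hbk, hkb, _, _⟩ => by omega⟩
  convert hr using 1
  omega

theorem exists_runSummary (S : List α) (b m : ℕ) :
    ∃ R : RunSummary, R.runStart + R.runEnd ≤ 2 * S.length - 1 ∧
      ∀ k ∈ longCenters S b m, manacherStart S k = R.palindromeStart k := by
  rcases (longCenters S b m).subsingleton_or_nontrivial with hsub | hnt
  · rcases hsub.eq_empty_or_singleton with hem | ⟨i, hi⟩
    · exact ⟨⟨0, 0, 0⟩, Nat.zero_le _, fun k hk => by simp [hem] at hk⟩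
    · have hin : i < 2 * S.length - 1 := (hi.ge (Set.mem_singleton i)).2.2.1
      refine ⟨⟨0, i + 1, manacherStart S i⟩, by dsimp only; omega, fun k hk => ?_⟩
      obtain rfl : k = i := hi.le hk
      simp only [RunSummary.palindromeStart, zero_add, if_true]
  · obtain ⟨i, hi, j, hj, hij⟩ := hnt.exists_lt
    obtain ⟨s, e, hr, hlong⟩ := exists_isMaximalRun_of_longCenters hi hj hij
    have hin := hlong i hi
    have hen := hr.inside
    refine ⟨⟨s, e, manacherStart S (s + e - 1)⟩, by dsimp only; omega, fun k hk => ?_⟩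
    have hpk := hlong k hk
    obtain ⟨hbi, -⟩ := hi
    obtain ⟨-, hjb, -⟩ := hj
    obtain ⟨-, -, hkn, hkl⟩ := hk
    simp only [RunSummary.palindromeStart]
    split_ifs with hke
    · rw [show s + e - 1 = k by omega]
    · exact (isMaximalPalindromeAt_manacher hkn).start_eq_of_isMaximalRun hr (by omega)
        (by omega) hpk.1 hpk.2 hke

end Runs

/-! ### Encoding Manacher arrays by right boundaries -/

section Code

variable {α : Type*} {S U V : List α} {i : ℕ}

/-- The rightmost end of a palindrome of `S` with a centre up to `i / 2`, as maintained by
Manacher's algorithm. -/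
noncomputable def rightBoundary (S : List α) (i : ℕ) : ℕ :=
  (Finset.range (i + 1)).sup fun j => manacherStart S j + manacherLen S j

theorem le_rightBoundary (S : List α) (i : ℕ) :
    manacherStart S i + manacherLen S i ≤ rightBoundary S i :=
  Finset.le_sup (f := fun j => manacherStart S j + manacherLen S j) (Finset.self_mem_range_succ i)

theorem rightBoundary_mono (S : List α) : Monotone (rightBoundary S) :=
  fun _ _ h => Finset.sup_mono (Finset.range_mono (Nat.succ_le_succ h))

theorem exists_eq_rightBoundary (S : List α) (i : ℕ) :
    ∃ j ≤ i, rightBoundary S i = manacherStart S j + manacherLen S j := by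
  obtain ⟨j, hj, h⟩ := Finset.exists_mem_eq_sup (Finset.range (i + 1)) ⟨0, by simp⟩
    fun j => manacherStart S j + manacherLen S j
  exact ⟨j, Finset.mem_range_succ_iff.1 hj, h⟩

theorem rightBoundary_le (h : i < 2 * S.length - 1) : rightBoundary S i ≤ S.length :=
  Finset.sup_le fun _ hj => (isMaximalPalindromeAt_manacher
    ((Finset.mem_range_succ_iff.1 hj).trans_lt h)).inside

/-- The step of Manacher's algorithm: if the palindrome of `V` with centre `i / 2` does not extend
the right boundary, then it is the mirror image of one with a smaller centre. -/
theorem manacherLen_le_of_rightBoundary_eq (hUV : U.length = V.length)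
    (hi : i < 2 * U.length - 1) (hR : rightBoundary U i = rightBoundary V i)
    (ih : ∀ j < i, manacherLen U j = manacherLen V j) : manacherLen V i ≤ manacherLen U i := by
  by_contra! hlt
  have hmU := isMaximalPalindromeAt_manacher hi
  have hmV := isMaximalPalindromeAt_manacher (hUV ▸ hi)
  have hcU := hmU.center
  have hcV := hmV.center
  have hinV := hmV.inside
  obtain ⟨c, hci, hc⟩ := exists_eq_rightBoundary U i
  have hle := le_rightBoundary V i
  have hci : c < i := hci.lt_of_ne (by rintro rfl; omega)
  have hcmU := isMaximalPalindromeAt_manacher (S := U) (i := c) (by omega)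
  have hcmV := isMaximalPalindromeAt_manacher (S := V) (i := c) (by omega)
  have hccU := hcmU.center
  have hinU := hcmU.inside
  rw [show manacherStart V c = manacherStart U c by simp only [manacherStart, ih c hci],
    ← ih c hci] at hcmV
  generalize manacherStart U c = A, manacherLen U c = L, manacherStart V i = a,
    manacherLen V i = l at *
  have mirrorV : IsPalindromeOn V (A + (A + L) - (a + l)) (A + (A + L) - a) :=
    hcmV.isPalindromeOn.mirror hmV.isPalindromeOn (by omega) (by omega)
  obtain ⟨j, hj⟩ : ∃ j, A + (A + L) - (a + l) + (A + (A + L) - a) = j + 1 :=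
    ⟨_, (Nat.succ_pred_eq_of_pos (by omega)).symm⟩
  have hji : j < i := by omega
  have hjmU := isMaximalPalindromeAt_manacher (S := U) (i := j) (by omega)
  have hjmV := isMaximalPalindromeAt_manacher (S := V) (i := j) (by omega)
  have mirrorU : IsPalindromeOn U (A + (A + L) - (a + l)) (A + (A + L) - a) := by
    rw [hjmU.isPalindromeOn_iff (by omega) hj, ih j hji]
    exact (hjmV.isPalindromeOn_iff (by omega) hj).1 mirrorV
  have hpalU := hcmU.isPalindromeOn.mirror mirrorU (by omega) (by omega)
  have := (hmU.isPalindromeOn_iff (by omega) (by omega)).1 hpalU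
  omega

theorem manacherLen_eq_of_rightBoundary_eq (hUV : U.length = V.length)
    (hR : ∀ i < 2 * U.length - 1, rightBoundary U i = rightBoundary V i) :
    manacherLen U = manacherLen V := by
  funext i
  induction i using Nat.strong_induction_on with
  | _ i ih =>
    rcases lt_or_ge i (2 * U.length - 1) with hi | hi
    · exact le_antisymm
        (manacherLen_le_of_rightBoundary_eq hUV.symm (hUV ▸ hi) (hR i hi).symm
          fun j hj => (ih j hj).symm)
        (manacherLen_le_of_rightBoundary_eq hUV hi (hR i hi) ih)
    · rw [manacherLen_eq_zero hi, manacherLen_eq_zero (hUV ▸ hi)]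

/-- The right boundaries of `S` form a monotone lattice path; these are the positions of its
horizontal steps. -/
noncomputable def boundarySteps (S : List α) : Finset ℕ :=
  Finset.univ.image fun i : Fin (2 * S.length - 1) => (i : ℕ) + rightBoundary S i

theorem strictMono_add_rightBoundary (S : List α) (n : ℕ) :
    StrictMono fun i : Fin n => (i : ℕ) + rightBoundary S i :=
  fun _ _ h => add_lt_add_of_lt_of_le h (rightBoundary_mono S (Fin.le_def.1 h.le))

theorem card_boundarySteps (S : List α) : (boundarySteps S).card = 2 * S.length - 1 := by
  rw [boundarySteps, Finset.card_image_of_injective _ (strictMono_add_rightBoundary S _).injective,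
    Finset.card_univ, Fintype.card_fin]

theorem manacherLen_eq_of_boundarySteps_eq (h : boundarySteps U = boundarySteps V) :
    manacherLen U = manacherLen V := by
  have hcard : 2 * U.length - 1 = 2 * V.length - 1 := by
    rw [← card_boundarySteps, ← card_boundarySteps, h]
  have hrange := congrArg (fun s : Finset ℕ => (s : Set ℕ)) h
  simp only [boundarySteps, Finset.coe_image, Finset.coe_univ, Set.image_univ] at hrange
  have hfun := ((strictMono_add_rightBoundary U (2 * U.length - 1)).range_inj
    (strictMono_add_rightBoundary V (2 * U.length - 1))).1 (by rw [hrange, hcard])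
  exact manacherLen_eq_of_rightBoundary_eq (by omega) fun j hj =>
    Nat.add_left_cancel (congrFun hfun ⟨j, hj⟩)

/-- A number that determines the Manacher array of `S`: the set of boundary steps in binary. -/
noncomputable def manacherCode (S : List α) : ℕ := ∑ x ∈ boundarySteps S, 2 ^ x

theorem manacherCode_lt (S : List α) : manacherCode S < 2 ^ (3 * S.length) := by
  refine Nat.geomSum_lt le_rfl fun k hk => ?_
  obtain ⟨i, -, rfl⟩ := Finset.mem_image.1 hk
  have hi := i.isLt
  have := rightBoundary_le hi
  omega

/-- The maximal palindrome lengths of the strings over `α` with Manacher code `c`. -/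
noncomputable def decodedLen (α : Type*) (c : ℕ) : ℕ → ℕ :=
  manacherLen (Function.invFun (manacherCode (α := α)) c)

theorem decodedLen_manacherCode (S : List α) : decodedLen α (manacherCode S) = manacherLen S :=
  manacherLen_eq_of_boundarySteps_eq <| Finset.geomSum_injective le_rfl <|
    Function.invFun_eq (f := manacherCode) ⟨S, rfl⟩

end Code

/-! ### Short palindromes are determined by a window -/

section Window

variable {α : Type*} {S : List α} {b i j m x N : ℕ}

theorem manacherLen_substr_le (hj : j < 2 * (substr S x N).length - 1) :
    manacherLen (substr S x N) j ≤ manacherLen S (2 * x + j) := by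
  have hw := isMaximalPalindromeAt_manacher hj
  have hin := hw.inside
  have hc := hw.center
  have hlen := length_substr S x N
  have hpal := (isPalindromeOn_substr_iff (by omega)).1 hw.isPalindromeOn
  have hS := isMaximalPalindromeAt_manacher (S := S) (i := 2 * x + j) (by omega)
  have := (hS.isPalindromeOn_iff (by omega) (by omega)).1 hpal
  omega

theorem manacherLen_substr_eq (hj : j < 2 * (substr S x N).length - 1)
    (hleft : x = 0 ∨ manacherLen (substr S x N) j ≤ j)
    (hright : S.length ≤ x + N ∨ j + 1 + manacherLen (substr S x N) j < 2 * N) :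
    manacherLen (substr S x N) j = manacherLen S (2 * x + j) := by
  refine (manacherLen_substr_le hj).eq_of_not_lt fun hlt => ?_
  have hw := isMaximalPalindromeAt_manacher hj
  have hc := hw.center
  have hlen := length_substr S x N
  have hS := isMaximalPalindromeAt_manacher (S := S) (i := 2 * x + j) (by omega)
  have hinS := hS.inside
  have hcS := hS.center
  generalize manacherStart (substr S x N) j = a, manacherLen (substr S x N) j = l at *
  have hpalS : IsPalindromeOn S (x + (a - 1)) (x + (a + l + 1)) :=
    (hS.isPalindromeOn_iff (by omega) (by omega)).2 (by omega)
  have hpal := (isPalindromeOn_substr_iff (N := N) (by omega)).2 hpalS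
  have := (hw.isPalindromeOn_iff (by omega) (by omega)).1 hpal
  omega

/-- The first position of the window for the centres `b / 2, …, (b + m - 1) / 2`. -/
def windowStart (b m : ℕ) : ℕ := b / 2 - m

/-- The factor of `S` that contains the palindromes of length less than `2 * m` with centres
`b / 2, …, (b + m - 1) / 2`, away from its ends. -/
def window (S : List α) (b m : ℕ) : List α := substr S (windowStart b m) (3 * m)

theorem length_window (S : List α) (b m : ℕ) :
    (window S b m).length = min (3 * m) (S.length - windowStart b m) :=
  length_substr S _ _

theorem two_mul_windowStart_le (hb : b ≤ i) : 2 * windowStart b m ≤ i := by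
  rw [windowStart]
  omega

theorem sub_windowStart_lt (hb : b ≤ i) (hm : i < b + m) (hi : i < 2 * S.length - 1) :
    i - 2 * windowStart b m < 2 * (window S b m).length - 1 := by
  rw [length_window, windowStart]
  omega

theorem manacherLen_window_le (hb : b ≤ i) (hm : i < b + m) (hi : i < 2 * S.length - 1) :
    manacherLen (window S b m) (i - 2 * windowStart b m) ≤ manacherLen S i := by
  have := manacherLen_substr_le (sub_windowStart_lt hb hm hi)
  rwa [Nat.add_sub_of_le (two_mul_windowStart_le hb)] at this

theorem manacherLen_window_eq (hb : b ≤ i) (hm : i < b + m) (hi : i < 2 * S.length - 1)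
    (hshort : manacherLen (window S b m) (i - 2 * windowStart b m) < 2 * m) :
    manacherLen (window S b m) (i - 2 * windowStart b m) = manacherLen S i := by
  have hx : windowStart b m = b / 2 - m := rfl
  have := manacherLen_substr_eq (sub_windowStart_lt hb hm hi)
    (by rw [window] at hshort; omega) (by rw [window] at hshort; omega)
  rwa [Nat.add_sub_of_le (two_mul_windowStart_le hb)] at this

theorem manacherStart_eq_of_window {R : RunSummary} (hb : b ≤ i) (hm : i < b + m)
    (hi : i < 2 * S.length - 1)
    (hR : ∀ k ∈ longCenters S b m, manacherStart S k = R.palindromeStart k) :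
    manacherStart S i =
      if manacherLen (window S b m) (i - 2 * windowStart b m) < 2 * m then
        (i + 1 - manacherLen (window S b m) (i - 2 * windowStart b m)) / 2
      else R.palindromeStart i := by
  split_ifs with hshort
  · rw [manacherLen_window_eq hb hm hi hshort, manacherStart]
  · have := manacherLen_window_le hb hm hi
    exact hR i ⟨hb, hm, hi, by omega⟩

end Window

/-! ### The query program -/

/-- The block record: the address `p` of a row of the table of window lengths, twice the first
position `x` of the window, and the long palindromes of the block. -/
def blockCell (p x : ℕ) (R : RunSummary) : ℕ → ℕ
  | 0 => p
  | 1 => x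
  | 2 => R.runStart
  | 3 => R.runEnd
  | _ => R.centralStart

namespace WordRAM

/-- Programs without `loop`; they run in constant time. -/
def Program.LoopFree : Program → Prop
  | .seq P Q => P.LoopFree ∧ Q.LoopFree
  | .ite _ P Q => P.LoopFree ∧ Q.LoopFree
  | .loop _ _ => False
  | _ => True

/-- The largest number of steps of a loop-free program. The value for a loop is a dummy. -/
def Program.maxSteps : Program → ℕ
  | .seq P Q => P.maxSteps + Q.maxSteps
  | .ite _ P Q => max P.maxSteps Q.maxSteps + 1
  | _ => 1

section Triples

variable {w : ℕ} {D : List (BitVec w)} {P P' : Program} {f : ℕ → ℕ} {Q : (ℕ → ℕ) → Prop}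
  {a b d x y z v : ℕ}

theorem Exec.le_maxSteps {s s' : Regs w} {t : ℕ} (h : Exec D P s s' t) (hP : P.LoopFree) :
    t ≤ P.maxSteps := by
  induction h with
  | skip | const | op | load => exact le_rfl
  | seq _ _ ihP ihQ => exact add_le_add (ihP hP.1) (ihQ hP.2)
  | ite_true _ _ ih => exact Nat.succ_le_succ ((ih hP.1).trans (le_max_left _ _))
  | ite_false _ _ ih => exact Nat.succ_le_succ ((ih hP.2).trans (le_max_right _ _))
  | loop_stop | loop_step => exact hP.elim

/-- The registers with the contents `f 0, f 1, …` modulo `2 ^ w`. -/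
def natRegs (w : ℕ) (f : ℕ → ℕ) : Regs w := fun r => BitVec.ofNat w (f r)

/-- Total correctness: with memory `D` and register contents `f`, the program `P` halts with
register contents that satisfy `Q`. Register contents are numbers here, so that word arithmetic
without overflow becomes arithmetic in `ℕ`. -/
def Achieves (D : List (BitVec w)) (P : Program) (f : ℕ → ℕ) (Q : (ℕ → ℕ) → Prop) : Prop :=
  ∃ g t, Exec D P (natRegs w f) (natRegs w g) t ∧ Q g

theorem natRegs_update : natRegs w (Function.update f d z) =
    Function.update (natRegs w f) d (BitVec.ofNat w z) :=
  funext fun r => Function.apply_update (fun _ => BitVec.ofNat w) f d z r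

theorem input_eq_natRegs (w i : ℕ) : input w i = natRegs w (Function.update (fun _ => 0) 0 i) :=
  natRegs_update.symm

theorem ofNat_inj_of_lt (hx : x < 2 ^ w) (hy : y < 2 ^ w) :
    BitVec.ofNat w x = BitVec.ofNat w y ↔ x = y := by
  rw [← BitVec.toNat_inj, BitVec.toNat_ofNat, BitVec.toNat_ofNat, Nat.mod_eq_of_lt hx,
    Nat.mod_eq_of_lt hy]

namespace Achieves

theorem mono {Q' : (ℕ → ℕ) → Prop} (h : Achieves D P f Q) (hQ : ∀ g, Q g → Q' g) :
    Achieves D P f Q' :=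
  let ⟨g, t, hP, hg⟩ := h
  ⟨g, t, hP, hQ g hg⟩

theorem seq (h : Achieves D P f fun g => Achieves D P' g Q) : Achieves D (.seq P P') f Q := by
  obtain ⟨g, t, hP, g', t', hP', hQ⟩ := h
  exact ⟨g', _, .seq hP hP', hQ⟩

theorem const (c : ℕ) (hQ : Q (Function.update f d c)) : Achieves D (.const d c) f Q :=
  ⟨_, 1, natRegs_update ▸ .const d c _, hQ⟩

theorem op {o : BinOp} (hx : f a = x) (hy : f b = y)
    (h : o.eval (BitVec.ofNat w x) (BitVec.ofNat w y) = BitVec.ofNat w z)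
    (hQ : Q (Function.update f d z)) : Achieves D (.op o d a b) f Q := by
  refine ⟨_, 1, ?_, hQ⟩
  rw [natRegs_update, ← h, ← hx, ← hy]
  exact .op o d a b _

theorem load (hD : D.length ≤ 2 ^ w) (hx : f a = x) (h : D[x]? = some (BitVec.ofNat w v))
    (hQ : Q (Function.update f d v)) : Achieves D (.load d a) f Q := by
  refine ⟨_, 1, natRegs_update ▸ .load d a _ _ ?_, hQ⟩
  have hlt := (List.getElem?_eq_some_iff.1 h).1
  rwa [natRegs, hx, BitVec.toNat_ofNat, Nat.mod_eq_of_lt (by omega)]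

theorem ite_of_ne_zero (ha : f a < 2 ^ w) (h₀ : f a ≠ 0) (h : Achieves D P f Q) :
    Achieves D (.ite a P P') f Q := by
  obtain ⟨g, t, hP, hQ⟩ := h
  exact ⟨g, _, .ite_true (mt (ofNat_inj_of_lt ha (Nat.two_pow_pos w)).1 h₀) hP, hQ⟩

theorem ite_of_eq_zero (h₀ : f a = 0) (h : Achieves D P' f Q) :
    Achieves D (.ite a P P') f Q := by
  obtain ⟨g, t, hP, hQ⟩ := h
  exact ⟨g, _, .ite_false (congrArg (BitVec.ofNat w) h₀) hP, hQ⟩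

theorem ite_of_decide {c : Prop} [Decidable c] (hw : 1 < 2 ^ w) (ha : f a = if c then 1 else 0)
    (hP : c → Achieves D P f Q) (hP' : ¬c → Achieves D P' f Q) :
    Achieves D (.ite a P P') f Q := by
  by_cases hc : c
  · rw [if_pos hc] at ha
    exact ite_of_ne_zero (by omega) (by omega) (hP hc)
  · rw [if_neg hc] at ha
    exact ite_of_eq_zero ha (hP' hc)

end Achieves

theorem eval_add : BinOp.add.eval (BitVec.ofNat w x) (BitVec.ofNat w y) =
    BitVec.ofNat w (x + y) := (BitVec.ofNat_add x y).symm

theorem eval_mul : BinOp.mul.eval (BitVec.ofNat w x) (BitVec.ofNat w y) =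
    BitVec.ofNat w (x * y) := (BitVec.ofNat_mul x y).symm

theorem eval_sub (h : y ≤ x) (hx : x < 2 ^ w) :
    BinOp.sub.eval (BitVec.ofNat w x) (BitVec.ofNat w y) = BitVec.ofNat w (x - y) :=
  BitVec.ofNat_sub_ofNat_of_le x y (h.trans_lt hx) h

theorem eval_div (hx : x < 2 ^ w) (hy : y < 2 ^ w) :
    BinOp.div.eval (BitVec.ofNat w x) (BitVec.ofNat w y) = BitVec.ofNat w (x / y) := by
  apply BitVec.eq_of_toNat_eq
  simp only [BinOp.eval, BitVec.toNat_udiv, BitVec.toNat_ofNat]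
  rw [Nat.mod_eq_of_lt hx, Nat.mod_eq_of_lt hy,
    Nat.mod_eq_of_lt ((Nat.div_le_self x y).trans_lt hx)]

theorem eval_shr_one (hx : x < 2 ^ w) (hw : 1 < 2 ^ w) :
    BinOp.shr.eval (BitVec.ofNat w x) (BitVec.ofNat w 1) = BitVec.ofNat w (x / 2) := by
  apply BitVec.eq_of_toNat_eq
  simp only [BinOp.eval, BitVec.ushiftRight_eq', BitVec.toNat_ushiftRight, BitVec.toNat_ofNat]
  rw [Nat.mod_eq_of_lt hx, Nat.mod_eq_of_lt hw, Nat.mod_eq_of_lt (by omega), Nat.shiftRight_one]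

theorem eval_lt (hx : x < 2 ^ w) (hy : y < 2 ^ w) :
    BinOp.lt.eval (BitVec.ofNat w x) (BitVec.ofNat w y) =
      BitVec.ofNat w (if x < y then 1 else 0) := by
  simp only [BinOp.eval, BitVec.lt_def, BitVec.toNat_ofNat]
  rw [Nat.mod_eq_of_lt hx, Nat.mod_eq_of_lt hy, apply_ite (BitVec.ofNat w)]

theorem eval_eq (hx : x < 2 ^ w) (hy : y < 2 ^ w) :
    BinOp.eq.eval (BitVec.ofNat w x) (BitVec.ofNat w y) =
      BitVec.ofNat w (if x = y then 1 else 0) := by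
  simp only [BinOp.eval, ofNat_inj_of_lt hx hy, apply_ite (BitVec.ofNat w)]

end Triples

local infixr:60 " ;; " => Program.seq

/-- `r0 := (r5 - r7) / 2`: the start position of a palindrome of length `r7`. Throughout, register
`5` holds `i + 1` for the queried centre `i / 2`, register `4` holds `1` and register `2` holds
`0`. -/
def startOfLength : Program := .op .sub 0 5 7 ;; .op .shr 0 0 4

/-- `r0 := R.palindromeStart i`, where `R` is stored in the cells after the address `r6`. -/
def startOfRun : Program :=
  .op .add 6 6 4 ;; .load 7 6 ;; .op .add 6 6 4 ;; .load 8 6 ;; .op .add 9 7 8 ;;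
  .op .lt 10 5 9 ;;
  .ite 10 (.op .add 0 7 2)
    (.op .eq 10 5 9 ;; .ite 10 (.op .add 6 6 4 ;; .load 0 6) (.op .sub 0 5 8))

/-- The start position in register `0`, from the record of the block of `i = r0`, for blocks of
`r3` centres. -/
def startOfBlock : Program :=
  .op .div 6 0 3 ;; .const 7 5 ;; .op .mul 6 7 6 ;;
  .op .add 6 6 4 ;; .load 7 6 ;; .op .add 6 6 4 ;; .load 8 6 ;;
  .op .sub 8 0 8 ;; .op .add 7 7 8 ;; .load 7 7 ;;
  .op .add 8 3 3 ;; .op .lt 8 7 8 ;; .ite 8 startOfLength startOfRun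

/-- The query program. Cell `0` holds the number of centres per block, or `0` if the other cells
hold the plain array of lengths. The last two instructions compute `r1 := i + 1 - 2 * r0`. -/
def queryProgram : Program :=
  .load 3 2 ;; .const 4 1 ;; .op .add 5 0 4 ;;
  .ite 3 startOfBlock (.load 7 5 ;; startOfLength) ;;
  .op .sub 1 5 0 ;; .op .sub 1 1 0

theorem queryProgram_loopFree : queryProgram.LoopFree := by
  simp only [queryProgram, startOfBlock, startOfRun, startOfLength, Program.LoopFree, and_self]

section Correctness

variable {w : ℕ} {D : List (BitVec w)} {f : ℕ → ℕ} {i a l m p x r : ℕ} {R : RunSummary}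

theorem achieves_startOfLength (h₄ : f 4 = 1) (h₅ : f 5 = i + 1) (h₇ : f 7 = l)
    (hi : i + 1 < 2 ^ w) (hl : l ≤ i + 1) :
    Achieves D startOfLength f fun g => g 0 = (i + 1 - l) / 2 ∧ g 5 = i + 1 :=
  .seq <| .op h₅ h₇ (eval_sub hl hi) <|
  .op (x := i + 1 - l) rfl h₄ (eval_shr_one (by omega) (by omega)) ⟨rfl, h₅⟩

theorem achieves_startOfRun (hD : D.length ≤ 2 ^ w) (h₂ : f 2 = 0) (h₄ : f 4 = 1)
    (h₅ : f 5 = i + 1) (h₆ : f 6 = r) (hi : i + 1 < 2 ^ w) (hR : R.runStart + R.runEnd < 2 ^ w)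
    (hstart : D[r + 1]? = some (BitVec.ofNat w R.runStart))
    (hend : D[r + 2]? = some (BitVec.ofNat w R.runEnd))
    (hcentral : D[r + 3]? = some (BitVec.ofNat w R.centralStart)) :
    Achieves D startOfRun f fun g => g 0 = R.palindromeStart i ∧ g 5 = i + 1 := by
  refine .seq <| .op h₆ h₄ eval_add <| .seq <| .load hD rfl hstart <|
    .seq <| .op (x := r + 1) rfl h₄ eval_add <| .seq <| .load hD rfl hend <|
    .seq <| .op (x := R.runStart) (y := R.runEnd) rfl rfl eval_add <|
    .seq <| .op h₅ rfl (eval_lt hi hR) <|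
    .ite_of_decide (c := i + 1 < R.runStart + R.runEnd) (by omega) rfl (fun hlt => ?_) fun hge => ?_
  · have hR' : R.palindromeStart i = R.runStart :=
      (if_neg hlt.ne).trans (max_eq_left (by omega))
    exact .op (x := R.runStart) rfl h₂ eval_add ⟨hR'.symm, h₅⟩
  refine .seq <| .op h₅ rfl (eval_eq hi hR) <|
    .ite_of_decide (c := i + 1 = R.runStart + R.runEnd) (by omega) rfl (fun heq => ?_) fun hne => ?_
  · exact .seq <| .op (x := r + 2) rfl h₄ eval_add <| .load hD rfl hcentral ⟨(if_pos heq).symm, h₅⟩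
  · have hR' : R.palindromeStart i = i + 1 - R.runEnd :=
      (if_neg hne).trans (max_eq_right (by omega))
    exact .op (y := R.runEnd) h₅ rfl (eval_sub (by omega) hi) ⟨hR'.symm, h₅⟩

theorem achieves_startOfBlock (hD : D.length ≤ 2 ^ w) (h₀ : f 0 = i) (h₂ : f 2 = 0)
    (h₃ : f 3 = m) (h₄ : f 4 = 1) (h₅ : f 5 = i + 1) (hi : i + 1 < 2 ^ w) (hm : 2 * m < 2 ^ w)
    (hR : R.runStart + R.runEnd < 2 ^ w) (hx : x ≤ i) (hl : l ≤ i + 1)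
    (hrec : ∀ r < 5, D[5 * (i / m) + (r + 1)]? = some (BitVec.ofNat w (blockCell p x R r)))
    (hrow : D[p + (i - x)]? = some (BitVec.ofNat w l))
    (ha : a = if l < 2 * m then (i + 1 - l) / 2 else R.palindromeStart i) :
    Achieves D startOfBlock f fun g => g 0 = a ∧ g 5 = i + 1 := by
  refine .seq <| .op h₀ h₃ (eval_div (by omega) (by omega)) <|
    .seq <| .const 5 <| .seq <| .op (x := 5) (y := i / m) rfl rfl eval_mul <|
    .seq <| .op (x := 5 * (i / m)) rfl h₄ eval_add <|
    .seq <| .load hD rfl (hrec 0 (by omega)) <|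
    .seq <| .op (x := 5 * (i / m) + 1) rfl h₄ eval_add <|
    .seq <| .load hD rfl (hrec 1 (by omega)) <|
    .seq <| .op h₀ rfl (eval_sub hx (by omega)) <|
    .seq <| .op (x := p) (y := i - x) rfl rfl eval_add <|
    .seq <| .load hD rfl hrow <|
    .seq <| .op (z := 2 * m) h₃ h₃ (by rw [eval_add, two_mul]) <|
    .seq <| .op (x := l) (y := 2 * m) rfl rfl (eval_lt (by omega) hm) <|
    .ite_of_decide (c := l < 2 * m) (by omega) rfl (fun hlt => ?_) fun hge => ?_
  · obtain rfl := ha.trans (if_pos hlt)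
    exact achieves_startOfLength h₄ h₅ rfl hi hl
  · obtain rfl := ha.trans (if_neg hge)
    exact achieves_startOfRun (r := 5 * (i / m) + 2) hD h₂ h₄ h₅ rfl hi hR (hrec 2 (by omega))
      (hrec 3 (by omega)) (hrec 4 (by omega))

theorem achieves_lengthOfStart (h : f 0 = a ∧ f 5 = i + 1) (hc : 2 * a + l = i + 1)
    (hi : i + 1 < 2 ^ w) :
    Achieves D (.op .sub 1 5 0 ;; .op .sub 1 1 0) f fun g => g 0 = a ∧ g 1 = l := by
  have hl : i + 1 - a - a = l := by omega
  exact .seq <| .op h.2 h.1 (eval_sub (by omega) hi) <|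
    .op (x := i + 1 - a) rfl h.1 (eval_sub (by omega) (by omega)) ⟨h.1, hl⟩

/-- With memory `D`, the query program computes the Manacher array of `S`. -/
def AnswersQueries {α : Type*} (D : List (BitVec w)) (S : List α) : Prop :=
  ∀ i < 2 * S.length - 1, Achieves D queryProgram (Function.update (fun _ => 0) 0 i)
    fun g => g 0 = manacherStart S i ∧ g 1 = manacherLen S i

theorem achieves_queryProgram (hD : D.length ≤ 2 ^ w) (hi : i + 1 < 2 ^ w)
    (hc : 2 * a + l = i + 1) (hm : D[0]? = some (BitVec.ofNat w m))
    (h : ∀ f, f 0 = i → f 2 = 0 → f 3 = m → f 4 = 1 → f 5 = i + 1 →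
      Achieves D (.ite 3 startOfBlock (.load 7 5 ;; startOfLength)) f
        fun g => g 0 = a ∧ g 5 = i + 1) :
    Achieves D queryProgram (Function.update (fun _ => 0) 0 i) fun g => g 0 = a ∧ g 1 = l :=
  .seq <| .load hD rfl hm <| .seq <| .const 1 <|
  .seq <| .op (x := i) (y := 1) rfl rfl eval_add <|
  .seq <| (h _ rfl rfl rfl rfl rfl).mono fun _ hg => achieves_lengthOfStart hg hc hi

theorem answersQueries_of_plain {α : Type*} {S : List α} (hD : D.length ≤ 2 ^ w)
    (hw : 2 * S.length ≤ 2 ^ w) (h₀ : D[0]? = some (BitVec.ofNat w 0))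
    (hlen : ∀ i < 2 * S.length - 1, D[i + 1]? = some (BitVec.ofNat w (manacherLen S i))) :
    AnswersQueries D S := by
  intro i hi
  have hc := (isMaximalPalindromeAt_manacher hi).center
  refine achieves_queryProgram hD (by omega) hc h₀ fun f _ _ h₃ h₄ h₅ =>
    .ite_of_eq_zero h₃ <| .seq <| .load hD h₅ (hlen i hi) ?_
  exact achieves_startOfLength h₄ h₅ rfl (by omega) (by omega)

theorem answersQueries_of_blocks {α : Type*} {S : List α} {p : ℕ → ℕ} {R : ℕ → RunSummary}
    (hD : D.length ≤ 2 ^ w) (hw : 2 * S.length ≤ 2 ^ w) (hm : 0 < m) (hmS : m < S.length)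
    (h₀ : D[0]? = some (BitVec.ofNat w m))
    (hrec : ∀ q ≤ 2 * S.length / m, ∀ r < 5, D[5 * q + (r + 1)]? =
      some (BitVec.ofNat w (blockCell (p q) (2 * windowStart (q * m) m) (R q) r)))
    (hrow : ∀ q, ∀ j < 2 * (window S (q * m) m).length - 1,
      D[p q + j]? = some (BitVec.ofNat w (manacherLen (window S (q * m) m) j)))
    (hR : ∀ q, (R q).runStart + (R q).runEnd ≤ 2 * S.length - 1)
    (hlong : ∀ q, ∀ k ∈ longCenters S (q * m) m, manacherStart S k = (R q).palindromeStart k) :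
    AnswersQueries D S := by
  intro i hi
  have hqi : i / m * m ≤ i := Nat.div_mul_le_self i m
  have hiq : i < i / m * m + m := Nat.lt_div_mul_add hm
  have hj := sub_windowStart_lt hqi hiq hi
  have hcw := (isMaximalPalindromeAt_manacher hj).center
  have hc := (isMaximalPalindromeAt_manacher hi).center
  have hRw := hR (i / m)
  exact achieves_queryProgram hD (by omega) hc h₀ fun f hf₀ hf₂ hf₃ hf₄ hf₅ =>
    .ite_of_ne_zero (by omega) (by omega) <|
    achieves_startOfBlock hD hf₀ hf₂ hf₃ hf₄ hf₅ (by omega) (by omega) (by omega)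
      (two_mul_windowStart_le hqi) (by omega) (hrec _ (Nat.div_le_div_right (by omega)))
      (hrow _ _ hj) (manacherStart_eq_of_window hqi hiq hi (hlong _))

end Correctness

/-! ### The memory content -/

section Memory

variable {α : Type*} {f : ℕ → ℕ} {w m n M c j q r : ℕ}

/-- The address of the table of window lengths, after the block width and the block records. -/
def tableStart (n m : ℕ) : ℕ := 1 + 5 * (2 * n / m + 1)

/-- The number of memory cells for a string of length `n` and blocks of `m` centres. The table has
a row of `6 * m` cells for each of the `2 ^ (9 * m)` codes of strings of length `3 * m`. -/
def memorySize (n m : ℕ) : ℕ := tableStart n m + 2 ^ (9 * m) * (6 * m)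

/-- The address of the row of the table for the window of the `q`-th block. -/
noncomputable def rowAddress (S : List α) (m q : ℕ) : ℕ :=
  tableStart S.length m + manacherCode (window S (q * m) m) * (6 * m)

/-- The memory content: the block width, the block records, and the table of window lengths. -/
noncomputable def memoryCell (S : List α) (m : ℕ) (R : ℕ → RunSummary) (j : ℕ) : ℕ :=
  if j = 0 then m
  else if j < tableStart S.length m then
    blockCell (rowAddress S m ((j - 1) / 5)) (2 * windowStart ((j - 1) / 5 * m) m)
      (R ((j - 1) / 5)) ((j - 1) % 5)
  else decodedLen α ((j - tableStart S.length m) / (6 * m)) ((j - tableStart S.length m) % (6 * m))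

theorem memoryCell_record (S : List α) (R : ℕ → RunSummary) (hq : q ≤ 2 * S.length / m)
    (hr : r < 5) : memoryCell S m R (5 * q + (r + 1)) =
      blockCell (rowAddress S m q) (2 * windowStart (q * m) m) (R q) r := by
  rw [memoryCell, if_neg (by omega), if_pos (by rw [tableStart]; omega),
    show (5 * q + (r + 1) - 1) / 5 = q by omega, show (5 * q + (r + 1) - 1) % 5 = r by omega]

theorem memoryCell_table (S : List α) (R : ℕ → RunSummary) (hj : j < 6 * m) :
    memoryCell S m R (tableStart S.length m + c * (6 * m) + j) = decodedLen α c j := by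
  have hpos : 0 < tableStart S.length m := by rw [tableStart]; omega
  obtain ⟨hdiv, hmod⟩ : (c * (6 * m) + j) / (6 * m) = c ∧ (c * (6 * m) + j) % (6 * m) = j :=
    (Nat.div_mod_unique (by omega)).2 ⟨by ring, hj⟩
  rw [memoryCell, if_neg (by omega), if_neg (by omega), add_assoc, Nat.add_sub_cancel_left, hdiv,
    hmod]

/-- The memory of `M` words with the contents `f 0, …, f (M - 1)` modulo `2 ^ w`. -/
def memoryList (w M : ℕ) (f : ℕ → ℕ) : List (BitVec w) :=
  List.ofFn fun j : Fin M => BitVec.ofNat w (f j)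

theorem length_memoryList (w M : ℕ) (f : ℕ → ℕ) : (memoryList w M f).length = M :=
  List.length_ofFn

theorem getElem?_memoryList (h : j < M) :
    (memoryList w M f)[j]? = some (BitVec.ofNat w (f j)) := by
  rw [memoryList, List.getElem?_ofFn, dif_pos h]

theorem exists_answersQueries_plain (S : List α) (hS : S ≠ []) (hw : 2 * S.length ≤ 2 ^ w) :
    ∃ D : List (BitVec w), D.length = 2 * S.length ∧ AnswersQueries D S := by
  have hpos := List.length_pos_iff.2 hS
  have hlen := length_memoryList w (2 * S.length)
    fun j => if j = 0 then 0 else manacherLen S (j - 1)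
  refine ⟨_, hlen, answersQueries_of_plain (hlen.trans_le hw) hw ?_ fun i hi => ?_⟩
  · rw [getElem?_memoryList (by omega), if_pos rfl]
  · rw [getElem?_memoryList (by omega), if_neg (Nat.succ_ne_zero i), Nat.add_sub_cancel]

theorem exists_answersQueries_blocks (S : List α) (hm : 0 < m) (hmS : m < S.length)
    (hM : memorySize S.length m ≤ 2 ^ w) (hw : 2 * S.length ≤ 2 ^ w) :
    ∃ D : List (BitVec w), D.length = memorySize S.length m ∧ AnswersQueries D S := by
  choose R hR hlong using fun q => exists_runSummary S (q * m) m
  have hlen := length_memoryList w (memorySize S.length m) (memoryCell S m R)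
  refine ⟨_, hlen, answersQueries_of_blocks (p := rowAddress S m) (hlen.trans_le hM) hw hm hmS
    ?_ (fun q hq r hr => ?_) (fun q j hj => ?_) hR hlong⟩
  · rw [getElem?_memoryList (by rw [memorySize, tableStart]; omega), memoryCell, if_pos rfl]
  · rw [getElem?_memoryList (by rw [memorySize, tableStart]; omega), memoryCell_record S R hq hr]
  · have hwin := length_window S (q * m) m
    have hj' : j < 6 * m := by omega
    have hcode : manacherCode (window S (q * m) m) < 2 ^ (9 * m) :=
      (manacherCode_lt _).trans_le (Nat.pow_le_pow_right two_pos (by omega))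
    have hrow := Nat.mul_le_mul_right (6 * m) (Nat.succ_le_of_lt hcode)
    rw [Nat.succ_mul] at hrow
    rw [getElem?_memoryList (by rw [memorySize, rowAddress]; omega), rowAddress,
      memoryCell_table S R hj', decodedLen_manacherCode]

theorem memorySize_mul_le (hm : 0 < m) (hn : 2 ^ (11 * m) ≤ n) : memorySize n m * m ≤ 22 * n := by
  have hmlt : m < 2 ^ m := Nat.lt_two_pow_self
  have hmn : m ≤ n := hmlt.le.trans ((Nat.pow_le_pow_right two_pos (by omega)).trans hn)
  have hrecords : tableStart n m * m ≤ 16 * n := by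
    have := Nat.div_mul_le_self (2 * n) m
    rw [tableStart]
    nlinarith
  have htable : 2 ^ (9 * m) * (6 * m) * m ≤ 6 * n :=
    calc 2 ^ (9 * m) * (6 * m) * m = 6 * (2 ^ (9 * m) * (m * m)) := by ring
      _ ≤ 6 * (2 ^ (9 * m) * (2 ^ m * 2 ^ m)) := by gcongr
      _ = 6 * 2 ^ (11 * m) := by ring
      _ ≤ 6 * n := Nat.mul_le_mul_left 6 hn
  rw [memorySize, add_mul]
  omega

theorem natCast_le_mul_div_logb {d C : ℕ} (hn : 2 ≤ n) (h : d * (Nat.log 2 n + 1) ≤ C * n) :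
    (d : ℝ) ≤ C * ((n : ℝ) / Real.logb 2 (n : ℝ)) := by
  have hn' : (1 : ℝ) < n := by exact_mod_cast hn
  have hlog : Real.logb 2 (n : ℝ) ≤ (Nat.log 2 n + 1 : ℕ) := by
    rw [Real.logb_le_iff_le_rpow one_lt_two (by positivity), Real.rpow_natCast]
    exact_mod_cast (Nat.lt_pow_succ_log_self one_lt_two n).le
  rw [← mul_div_assoc, le_div_iff₀ (Real.logb_pos one_lt_two hn')]
  calc (d : ℝ) * Real.logb 2 (n : ℝ) ≤ d * (Nat.log 2 n + 1 : ℕ) := by gcongr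
    _ ≤ C * n := by exact_mod_cast h

theorem exists_answersQueries (S : List α) (hS : 2 ≤ S.length) (hw : 2 * S.length ≤ 2 ^ w) :
    ∃ D : List (BitVec w),
      (D.length : ℝ) ≤ (484 : ℕ) * ((S.length : ℝ) / Real.logb 2 (S.length : ℝ)) ∧
      AnswersQueries D S := by
  obtain ⟨m, hm⟩ : ∃ m, m = Nat.log 2 S.length / 11 := ⟨_, rfl⟩
  rcases lt_or_ge m 22 with hlt | hge
  · obtain ⟨D, hD, hans⟩ := exists_answersQueries_plain S (by rintro rfl; simp at hS) hw
    have hlog : Nat.log 2 S.length + 1 ≤ 242 := by omega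
    exact ⟨D, natCast_le_mul_div_logb hS (by rw [hD]; nlinarith), hans⟩
  · have hn : 2 ^ (11 * m) ≤ S.length :=
      (Nat.pow_le_pow_right two_pos (by omega)).trans (Nat.pow_log_le_self 2 (by omega))
    have hmS : m < S.length :=
      Nat.lt_two_pow_self.trans_le ((Nat.pow_le_pow_right two_pos (by omega)).trans hn)
    have hsize := memorySize_mul_le (by omega) hn
    -- `22 ≤ m` makes the memory small enough for its addresses to fit into words.
    obtain ⟨D, hD, hans⟩ := exists_answersQueries_blocks S (by omega) hmS
      (show memorySize S.length m ≤ 2 ^ w by nlinarith) hw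
    refine ⟨D, natCast_le_mul_div_logb hS ?_, hans⟩
    have hlog : Nat.log 2 S.length + 1 ≤ 22 * m := by omega
    rw [hD]
    nlinarith

end Memory

end WordRAM

theorem one_le_logStar {n : ℕ} (hn : 2 ≤ n) : 1 ≤ logStar n := by
  rw [logStar, if_pos (Nat.lt_of_succ_le hn)]
  exact Nat.le_add_left 1 _

theorem theorem1_general :
    ∃ (P : WordRAM.Program) (C : ℕ),
      ∀ (α : Type*) (S : List α) (A : Fin (2 * S.length - 1) → ℕ × ℕ),
        2 ≤ S.length → IsManacherArray S A →
        ∀ w : ℕ, 2 * S.length ≤ 2 ^ w →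
          ∃ D : List (BitVec w),
            (D.length : ℝ) ≤ C * ((S.length : ℝ) / Real.logb 2 (S.length : ℝ)) ∧
            ∀ i : Fin (2 * S.length - 1), ∃ (s : WordRAM.Regs w) (t : ℕ),
              WordRAM.Exec D P (WordRAM.input w i) s t ∧
              t ≤ C ∧
              ((s 0).toNat, (s 1).toNat) = A i := by
  refine ⟨WordRAM.queryProgram, 484, fun α S A hS hA w hw => ?_⟩
  obtain ⟨D, hD, hans⟩ := WordRAM.exists_answersQueries S hS hw
  refine ⟨D, hD, fun i => ?_⟩
  obtain ⟨g, t, hexec, hstart, hlen⟩ := hans i i.isLt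
  have hin := (isMaximalPalindromeAt_manacher i.isLt).inside
  refine ⟨_, t, WordRAM.input_eq_natRegs w i ▸ hexec,
    (hexec.le_maxSteps WordRAM.queryProgram_loopFree).trans (by decide), ?_⟩
  refine Eq.trans ?_ ((hA i).eq_manacher i.isLt).symm
  simp only [WordRAM.natRegs, hstart, hlen, BitVec.toNat_ofNat]
  rw [Nat.mod_eq_of_lt (by omega), Nat.mod_eq_of_lt (by omega)]

theorem theorem1 :
    ∃ (P : WordRAM.Program) (C : ℕ),
      ∀ (α : Type*) (S : List α) (A : Fin (2 * S.length - 1) → ℕ × ℕ),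
        2 ≤ S.length → IsManacherArray S A →
        -- every word size that can hold each index of the Manacher array
        ∀ w : ℕ, 2 * S.length ≤ 2 ^ w →
          ∃ D : List (BitVec w),
            (D.length : ℝ) ≤ C * ((S.length : ℝ) / Real.logb 2 (S.length : ℝ)) ∧
            ∀ i : Fin (2 * S.length - 1), ∃ (s : WordRAM.Regs w) (t : ℕ),
              WordRAM.Exec D P (WordRAM.input w i) s t ∧
              t ≤ C * logStar S.length ∧
              ((s 0).toNat, (s 1).toNat) = A i := by
  obtain ⟨P, C, h⟩ := theorem1_general
  refine ⟨P, C, fun α S A hS hA w hw => (h α S A hS hA w hw).imp fun D hD => ⟨hD.1, fun i => ?_⟩⟩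
  obtain ⟨s, t, hexec, ht, hsA⟩ := hD.2 i
  exact ⟨s, t, hexec, ht.trans (Nat.le_mul_of_pos_right C (one_le_logStar hS)), hsA⟩
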